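/- Fix a set $V$ of propositional variables and let $\Gamma_0$ be the Feferman–Schütte ordinal. **The calculus $\mathbf{RC}_{\Lambda}$.** For an ordinal $\Lambda$, let $\mathbb F_\Lambda$ be the set of formulas $\varphi ::= \top \mid p \mid (\varphi\wedge\psi) \mid \langle\alpha\rangle\varphi$ with $p\in V$ and $\alpha<\Lambda$. The calculus $\mathbf{RC}_\Lambda$ derives sequents $\varphi\vdash\psi$ with $\varphi,\psi\in\mathbb F_\Lambda$ from the axioms $\varphi\vdash\varphi$; $\varphi\vdash\top$; $\varphi\wedge\psi\vdash\varphi$; $\varphi\wedge\psi\vdash\psi$; $\langle\alpha\rangle\langle\alpha\rangle\varphi\vdash\langle\alpha\rangle\varphi$; and, for $\alpha>\beta$, $\langle\alpha\rangle\varphi\vdash\langle\beta\rangle\varphi$ and $\langle\alpha\rangle\varphi\wedge\langle\beta\rangle\psi\vdash\langle\alpha\rangle(\varphi\wedge\langle\beta\rangle\psi)$; by the rules: from $\varphi\vdash\psi$ and $\varphi\vdash\chi$ infer $\varphi\vdash\psi\wedge\chi$; from $\varphi\vdash\psi$ and $\psi\vdash\chi$ infer $\varphi\vdash\chi$; from $\varphi\vdash\psi$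 infer $\langle\alpha\rangle\varphi\vdash\langle\alpha\rangle\psi$. **Worms.** The set $\mathbb W_{\Gamma_0}$ of worms consists of the formulas $\langle\alpha_1\rangle\cdots\langle\alpha_n\rangle\top$ with $n\ge 0$ and all $\alpha_i<\Gamma_0$. For worms put $B\prec A$ iff $A\vdash\langle 0\rangle B$ is derivable in $\mathbf{RC}_{\Gamma_0}$, and let $o(A)=\sup_{B\prec A}(o(B)+1)$ be the order type of $A$. **Bracket Calculus.** Let $\mathbb W_{()}$ be the least set containing $\top$ and containing $(a)\,b$ whenever it contains $a$ and $b$; write $()\,b$ for $(\top)\,b$. Let $\mathbb F_{()}$ be the set of $\mathbf{BC}$-formulas $\varphi ::= \top \mid p \mid (\varphi\wedge\psi) \mid (a)\,\varphi$ with $p\in V$ and $a\in\mathbb W_{()}$, so that $\mathbb W_{()}\subseteq\mathbb F_{()}$. Write $b\lhd a$ if $a\vdash ()\,b$ is derivable in $\mathbf{BC}$, and $b\unlhd a$ if $a\vdash ()\,b$ or $a\vdash b$ is derivable in $\mathbf{BC}$. The calculus $\mathbf{BC}$ derives sequents from the axioms $\varphi\vdash\varphi$; $\varphi\vdash\top$;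 $\varphi\wedge\psi\vdash\varphi$; $\varphi\wedge\psi\vdash\psi$ by the rules: from $\varphi\vdash\psi$ and $\varphi\vdash\chi$ infer $\varphi\vdash\psi\wedge\chi$; from $\varphi\vdash\psi$ and $\psi\vdash\chi$ infer $\varphi\vdash\chi$; if $b\unlhd a$, from $\varphi\vdash\psi$ infer $(a)\,\varphi\vdash(b)\,\psi$ and $(a)\,(b)\,\varphi\vdash(b)\,\psi$; if $b\lhd a$, infer $(a)\,\varphi\wedge(b)\,\psi\vdash(a)\,(\varphi\wedge(b)\,\psi)$. **Translation.** For $a\in\mathbb W_{()}$ define $a^\ast$ by $\top^\ast=\top$ and $((a)\,b)^\ast=\langle o(a^\ast)\rangle b^\ast$, and put $o^\ast(a)=o(a^\ast)$. For $\varphi\in\mathbb F_{()}$ define $\varphi^\tau$ by $\top^\tau=\top$, $p^\tau=p$, $(\varphi\wedge\psi)^\tau=\varphi^\tau\wedge\psi^\tau$ and $((a)\,\varphi)^\tau=\langle o^\ast(a)\rangle\varphi^\tau$. **Theorem.** The relation $\prec$ on $\mathbb W_{\Gamma_0}$ is well-founded (so that $o$, $o^\ast$ and $\tau$ are well defined),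 $\varphi^\tau\in\mathbb F_{\Gamma_0}$ for every $\varphi\in\mathbb F_{()}$, and for all $\varphi,\psi\in\mathbb F_{()}$, $$\varphi\vdash_{\mathbf{BC}}\psi\quad\Longleftrightarrow\quad \varphi^\tau\vdash_{\mathbf{RC}_{\Gamma_0}}\psi^\tau .$$ -/

import Mathlib

universe u

namespace BracketCalculus

/-! ### The reflection calculus -/

/-- Strictly positive modal formulas over a set `V` of propositional variables, with a modality
`⟨α⟩` for each ordinal `α`. -/
inductive RCFormula (V : Type u) : Type (max u 1)
  | top : RCFormula V
  | var (p : V) : RCFormula V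
  | and (φ ψ : RCFormula V) : RCFormula V
  | dia (α : Ordinal.{0}) (φ : RCFormula V) : RCFormula V

/-- The signature of a formula: the set of ordinals occurring in its modalities. -/
def RCFormula.signature {V : Type u} : RCFormula V → Set Ordinal.{0}
  | .top => ∅
  | .var _ => ∅
  | .and φ ψ => φ.signature ∪ ψ.signature
  | .dia α φ => {α} ∪ φ.signature

/-- The language `𝔽_Λ`: formulas all of whose modalities are `⟨α⟩` with `α < Λ`. -/
def lang (V : Type u) (Λ : Ordinal.{0}) : Set (RCFormula V) :=
  {φ | ∀ α ∈ φ.signature, α < Λ}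

/-- `RC Λ φ ψ` says that the sequent `φ ⊢ ψ` is derivable in the reflection calculus `RC_Λ`.
The side conditions `_ ∈ lang V Λ` and `α < Λ` say that every formula occurring in a derivation
belongs to `𝔽_Λ`. -/
inductive RC {V : Type u} (Λ : Ordinal.{0}) : RCFormula V → RCFormula V → Prop
  | refl {φ : RCFormula V} (hφ : φ ∈ lang V Λ) : RC Λ φ φ
  | top {φ : RCFormula V} (hφ : φ ∈ lang V Λ) : RC Λ φ .top
  | and_left {φ ψ : RCFormula V} (hφ : φ ∈ lang V Λ) (hψ : ψ ∈ lang V Λ) : RC Λ (.and φ ψ) φ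
  | and_right {φ ψ : RCFormula V} (hφ : φ ∈ lang V Λ) (hψ : ψ ∈ lang V Λ) : RC Λ (.and φ ψ) ψ
  | dia_dia {α : Ordinal.{0}} {φ : RCFormula V} (hα : α < Λ) (hφ : φ ∈ lang V Λ) :
      RC Λ (.dia α (.dia α φ)) (.dia α φ)
  | dia_mono {α β : Ordinal.{0}} {φ : RCFormula V} (hα : α < Λ) (hβα : β < α)
      (hφ : φ ∈ lang V Λ) : RC Λ (.dia α φ) (.dia β φ)
  | dia_and {α β : Ordinal.{0}} {φ ψ : RCFormula V} (hα : α < Λ) (hβα : β < α)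
      (hφ : φ ∈ lang V Λ) (hψ : ψ ∈ lang V Λ) :
      RC Λ (.and (.dia α φ) (.dia β ψ)) (.dia α (.and φ (.dia β ψ)))
  | and_intro {φ ψ χ : RCFormula V} : RC Λ φ ψ → RC Λ φ χ → RC Λ φ (.and ψ χ)
  | cut {φ ψ χ : RCFormula V} : RC Λ φ ψ → RC Λ ψ χ → RC Λ φ χ
  | dia_congr {α : Ordinal.{0}} {φ ψ : RCFormula V} (hα : α < Λ) :
      RC Λ φ ψ → RC Λ (.dia α φ) (.dia α ψ)

/-! ### Worms and their order types -/

/-- The set `𝕎_Λ` of worms: formulas `⟨α₁⟩ … ⟨αₙ⟩ ⊤` with all `αᵢ < Λ`. -/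
inductive IsWorm {V : Type u} (Λ : Ordinal.{0}) : RCFormula V → Prop
  | top : IsWorm Λ .top
  | dia {α : Ordinal.{0}} {A : RCFormula V} : α < Λ → IsWorm Λ A → IsWorm Λ (.dia α A)

/-- The strict consistency ordering of `𝕎_Λ`: `B ≺ A` iff `A ⊢ ⟨0⟩ B` in `RC_Λ`. Formulas that
are not worms are related to nothing. -/
def WormLT {V : Type u} (Λ : Ordinal.{0}) (B A : RCFormula V) : Prop :=
  IsWorm Λ B ∧ IsWorm Λ A ∧ RC Λ A (.dia 0 B)

/-- The worms of `𝕎_Λ` form a set of the size of a type in the lowest universe, so that suprema of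
ordinals indexed by worms exist. -/
instance small_isWorm {V : Type u} (Λ : Ordinal.{0}) :
    Small.{0} {A : RCFormula V // IsWorm Λ A} := by
  let f : List (Set.Iio Λ) → {A : RCFormula V // IsWorm Λ A} := fun l =>
    l.foldr (fun α A => ⟨.dia α.1 A.1, .dia α.2 A.2⟩) ⟨.top, .top⟩
  refine small_of_surjective (f := f) ?_
  rintro ⟨A, hA⟩
  induction hA with
  | top => exact ⟨[], rfl⟩
  | @dia α A hα hA ih =>
    obtain ⟨l, hl⟩ := ih
    refine ⟨⟨α, hα⟩ :: l, ?_⟩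
    have hval : (f l).1 = A := by rw [hl]
    exact Subtype.ext (congrArg (RCFormula.dia α) hval)

instance small_wormLT {V : Type u} (Λ : Ordinal.{0}) (A : RCFormula V) :
    Small.{0} {B : RCFormula V // WormLT Λ B A} :=
  small_of_injective (β := {B : RCFormula V // IsWorm Λ B}) (f := fun B => ⟨B.1, B.2.1⟩)
    (fun B C h => Subtype.ext (by simpa using h))

open Classical in
/-- The order type `o(A)` of a worm `A` in the consistency ordering of `𝕎_Λ`, given by the recursion
`o(A) = sup_{B ≺ A} (o(B) + 1)` along the well-founded relation `≺` (and by the dummy value `0` if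
`≺` were not well-founded; it always is). -/
noncomputable def orderType {V : Type u} (Λ : Ordinal.{0}) (A : RCFormula V) : Ordinal.{0} :=
  if h : WellFounded (WormLT (V := V) Λ) then
    h.fix (C := fun _ => Ordinal.{0}) (fun A o => ⨆ B : {B : RCFormula V // WormLT Λ B A}, (o B.1 B.2 + 1)) A
  else 0

theorem orderType_eq {V : Type u} (Λ : Ordinal.{0}) (h : WellFounded (WormLT (V := V) Λ))
    (A : RCFormula V) :
    orderType Λ A = ⨆ B : {B : RCFormula V // WormLT Λ B A}, (orderType Λ B.1 + 1) := by
  simp only [orderType, dif_pos h]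
  rw [WellFounded.fix_eq]

/-! ### Bracket worms, the bracket calculus and its translation -/

/-- Bracket notations: `⊤`, and `(a) b` for bracket notations `a` and `b`. -/
inductive BracketWorm : Type
  | top : BracketWorm
  | br (a b : BracketWorm) : BracketWorm

/-- The translation `a ↦ a*` of bracket notations into worms, where `⊤* = ⊤` and
`((a) b)* = ⟨o(a*)⟩ b*`, with `o` computed among the worms of `𝕎_{Γ₀}`. -/
noncomputable def BracketWorm.star (V : Type u) : BracketWorm → RCFormula V
  | .top => .top
  | .br a b => .dia (orderType (Ordinal.gamma 0) (a.star V)) (b.star V)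

/-- The ordinal `o*(a) = o(a*)` denoted by the bracket notation `a`. -/
noncomputable def BracketWorm.oStar (V : Type u) (a : BracketWorm) : Ordinal.{0} :=
  orderType (Ordinal.gamma 0) (a.star V)

/-- Formulas of the bracket calculus over a set `V` of propositional variables. -/
inductive BCFormula (V : Type u) : Type u
  | top : BCFormula V
  | var (p : V) : BCFormula V
  | and (φ ψ : BCFormula V) : BCFormula V
  | br (a : BracketWorm) (φ : BCFormula V) : BCFormula V

/-- Bracket notations regarded as formulas of the bracket calculus. -/
def BracketWorm.toFormula {V : Type u} : BracketWorm → BCFormula V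
  | .top => .top
  | .br a b => .br a b.toFormula

/-- `BC φ ψ` says that the sequent `φ ⊢ ψ` is derivable in the bracket calculus. The condition
`b ⊴ a`, which means that `a ⊢ () b` or `a ⊢ b` is derivable, is split into its two cases: the rules
with `lt` in their name have the premise `b ⊲ a`, that is `a ⊢ () b`, and those with `le` have the
premise `a ⊢ b`. -/
inductive BC {V : Type u} : BCFormula V → BCFormula V → Prop
  | refl (φ : BCFormula V) : BC φ φ
  | top (φ : BCFormula V) : BC φ .top
  | and_left (φ ψ : BCFormula V) : BC (.and φ ψ) φ
  | and_right (φ ψ : BCFormula V) : BC (.and φ ψ) ψ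
  | and_intro {φ ψ χ : BCFormula V} : BC φ ψ → BC φ χ → BC φ (.and ψ χ)
  | cut {φ ψ χ : BCFormula V} : BC φ ψ → BC ψ χ → BC φ χ
  | br_lt {φ ψ : BCFormula V} {a b : BracketWorm} :
      BC φ ψ → BC a.toFormula (.br .top b.toFormula) → BC (.br a φ) (.br b ψ)
  | br_le {φ ψ : BCFormula V} {a b : BracketWorm} :
      BC φ ψ → BC a.toFormula b.toFormula → BC (.br a φ) (.br b ψ)
  | br_br_lt {φ ψ : BCFormula V} {a b : BracketWorm} :
      BC φ ψ → BC a.toFormula (.br .top b.toFormula) → BC (.br a (.br b φ)) (.br b ψ)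
  | br_br_le {φ ψ : BCFormula V} {a b : BracketWorm} :
      BC φ ψ → BC a.toFormula b.toFormula → BC (.br a (.br b φ)) (.br b ψ)
  | br_and {φ ψ : BCFormula V} {a b : BracketWorm} :
      BC a.toFormula (.br .top b.toFormula) →
      BC (.and (.br a φ) (.br b ψ)) (.br a (.and φ (.br b ψ)))

/-- The translation `φ ↦ φ^τ`, which replaces each bracket `(a)` by the modality `⟨o*(a)⟩`. -/
noncomputable def BCFormula.tau {V : Type u} : BCFormula V → RCFormula V
  | .top => .top
  | .var p => .var p
  | .and φ ψ => .and φ.tau ψ.tau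
  | .br a φ => .dia (a.oStar V) φ.tau

end BracketCalculus

/-!
The two calculi are related through the ordinal ranks of worms.

*Ranks.* `wormRank` assigns an ordinal to every word of modalities, by recursion on its
decomposition into a head and a body at its least letter, using addition, `ω ^ ·` and the
hyperexponentials `hyperexp` built from the Veblen hierarchy; since `Γ₀` is closed under these,
worms of `𝕎_{Γ₀}` have ranks below `Γ₀`. By `ReflectionCalculus.precedes_trichotomy`, in every
calculus that satisfies the laws of the reflection calculus two worms `A` and `B` satisfy
`A ⊢ ⟨0⟩ B`, or `B ⊢ ⟨0⟩ A`, or are equivalent, and their ranks compare in the same way.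

*Irreflexivity.* `A ⊢ ⟨0⟩ A` is never derivable (`RC.not_dia_self`). A derivation uses finitely many
modalities, and for any finite set of them there is an algebraic model in which each modality
increases an ordinal rank. Such models are built by adding modalities from the greatest down
(`RankedAlgebra.extend`): the new elements are pairs of an old element `m` of rank `r` and a
multiple of `ω ^ r`, which serves as the new rank.

*Well-foundedness.* By the two previous points `B ≺ A` implies that `B` has a smaller rank than `A`.
So `≺` is well-founded, and `o(A)` is at most the rank of `A`, hence less than `Γ₀`.

*Soundness.* The premises `b ⊴ a` and `b ⊲ a` of the bracket calculus translate into `o*(b) ≤ o*(a)`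
and `o*(b) < o*(a)`, so its rules become derivable rules of `RC_{Γ₀}` (`BC.rc_tau`).

*Completeness.* Conversely, `o*(b) ≤ o*(a)` implies `b ⊴ a`, and `o*(b) < o*(a)` implies `b ⊲ a`:
any two bracket notations are comparable within the bracket calculus (`comparable`), by induction
and the trichotomy above, and soundness excludes the unwanted cases. The theories of the bracket
calculus then form a Kripke model (`Theory.Rel`) that has an accessibility relation for every
ordinal and validates all of `RC_{Γ₀}`, while `φ^τ` is true in a theory exactly if `φ` belongs to it
(`Theory.sat_tau`). In particular, the argument does not depend on which ordinals have the form
`o*(a)`.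
-/

namespace BracketCalculus

open Ordinal

/-! ### Hyperexponentials -/

/-- The hyperexponential `φ_{γ₁} ∘ ⋯ ∘ φ_{γₙ}` for `α = ω ^ γ₁ + ⋯ + ω ^ γₙ` in Cantor normal form,
where `φ` is the Veblen hierarchy starting from `φ₀ ξ = ω ^ ξ`. -/
noncomputable def hyperexp (α x : Ordinal.{0}) : Ordinal.{0} :=
  open Classical in
  if h : α = 0 then x else
    have : α - ω ^ log ω α < α := sub_omega0_opow_log_lt h
    veblen (log ω α) (hyperexp (α - ω ^ log ω α) x)
termination_by α

theorem hyperexp_zero (x : Ordinal.{0}) : hyperexp 0 x = x := by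
  rw [hyperexp]; simp

theorem hyperexp_of_ne_zero {α : Ordinal.{0}} (h : α ≠ 0) (x : Ordinal.{0}) :
    hyperexp α x = veblen (log ω α) (hyperexp (α - ω ^ log ω α) x) := by
  rw [hyperexp]; simp [h]

theorem hyperexp_one (x : Ordinal.{0}) : hyperexp 1 x = ω ^ x := by
  rw [hyperexp_of_ne_zero one_ne_zero]
  simp [hyperexp_zero]

theorem strictMono_hyperexp (α : Ordinal.{0}) : StrictMono (hyperexp α) := by
  induction α using WellFoundedLT.induction with
  | ind α ih =>
    intro x y hxy
    by_cases h : α = 0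
    · subst h; simpa [hyperexp_zero] using hxy
    · rw [hyperexp_of_ne_zero h, hyperexp_of_ne_zero h]
      exact veblen_right_strictMono _ (ih _ (sub_omega0_opow_log_lt h) hxy)

/-- Values of `φ_δ` are fixed points of the lower functions of the Veblen hierarchy. -/
theorem hyperexp_veblen_of_log_lt {α δ : Ordinal.{0}} (h : log ω α < δ) (y : Ordinal.{0}) :
    hyperexp α (veblen δ y) = veblen δ y := by
  induction α using WellFoundedLT.induction with
  | ind α ih =>
    by_cases h0 : α = 0
    · subst h0; rw [hyperexp_zero]
    · rw [hyperexp_of_ne_zero h0, ih _ (sub_omega0_opow_log_lt h0), veblen_veblen_of_lt h]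
      exact (log_mono_right _ (sub_omega0_opow_log_lt h0).le).trans_lt h

/-- Terms absorbed in the sum `α + β` correspond to functions absorbed in the composition. -/
theorem hyperexp_add (α β x : Ordinal.{0}) :
    hyperexp (α + β) x = hyperexp α (hyperexp β x) := by
  induction α using WellFoundedLT.induction with
  | ind α ih =>
    by_cases hα : α = 0
    · subst hα; simp [hyperexp_zero]
    by_cases hβ : β = 0
    · subst hβ; simp [hyperexp_zero]
    rcases lt_or_ge (log ω α) (log ω β) with h | h
    · have hlt : α < ω ^ log ω β := (lt_opow_iff_log_lt one_lt_omega0 hα).2 h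
      rw [add_of_omega0_opow_le hlt (opow_log_le_self ω hβ), hyperexp_of_ne_zero hβ,
        hyperexp_veblen_of_log_lt h]
    · have hdecomp : ω ^ log ω α + (α - ω ^ log ω α) = α :=
        Ordinal.add_sub_cancel_of_le (opow_log_le_self ω hα)
      have hlog : log ω (α + β) = log ω α := by
        rw [log_eq_iff one_lt_omega0 (by simp [hα])]
        refine ⟨(opow_log_le_self ω hα).trans le_self_add, ?_⟩
        refine isPrincipal_add_omega0_opow _ (lt_opow_succ_log_self one_lt_omega0 α) ?_
        exact (lt_opow_iff_log_lt one_lt_omega0 hβ).2 (h.trans_lt (Order.lt_succ _))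
      have hsub : α + β - ω ^ log ω α = (α - ω ^ log ω α) + β := by
        conv_lhs => rw [← hdecomp, add_assoc]
        rw [hdecomp, Ordinal.add_sub_cancel]
      rw [hyperexp_of_ne_zero (by simp [hα] : α + β ≠ 0), hlog, hsub,
        ih _ (sub_omega0_opow_log_lt hα), hyperexp_of_ne_zero hα]

theorem veblen_lt_gamma_zero {a b : Ordinal.{0}} (ha : a < gamma 0) (hb : b < gamma 0) :
    veblen a b < gamma 0 := by
  have h : veblen a b < veblen (gamma 0) 0 :=
    veblen_lt_veblen_iff.2 (Or.inr (Or.inl ⟨ha, by rwa [veblen_gamma_zero]⟩))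
  rwa [veblen_gamma_zero] at h

theorem omega0_opow_lt_gamma_zero {a : Ordinal.{0}} (ha : a < gamma 0) : ω ^ a < gamma 0 := by
  simpa using veblen_lt_gamma_zero gamma_pos ha

theorem add_lt_gamma_zero {a b : Ordinal.{0}} (ha : a < gamma 0) (hb : b < gamma 0) :
    a + b < gamma 0 := by
  have h : ω ^ gamma 0 = gamma 0 := by
    conv_lhs => rw [← veblen_gamma_zero 0, ← veblen_zero_apply, veblen_veblen_of_lt gamma_pos]
    exact veblen_gamma_zero 0
  have := isPrincipal_add_omega0_opow (gamma 0) (h.symm ▸ ha) (h.symm ▸ hb)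
  rwa [h] at this

theorem hyperexp_lt_gamma_zero {α x : Ordinal.{0}} (hα : α < gamma 0) (hx : x < gamma 0) :
    hyperexp α x < gamma 0 := by
  induction α using WellFoundedLT.induction with
  | ind α ih =>
    by_cases h : α = 0
    · subst h; rwa [hyperexp_zero]
    · rw [hyperexp_of_ne_zero h]
      exact veblen_lt_gamma_zero ((log_le_self _ _).trans_lt hα)
        (ih _ (sub_omega0_opow_log_lt h) ((sub_omega0_opow_log_lt h).trans hα))

/-! ### Ordinal ranks of words -/

section Rank

variable {ι : Type*} (rk : ι → Ordinal.{0})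

/-- The longest initial segment of a word consisting of letters of rank above `α`. -/
noncomputable def head (α : Ordinal.{0}) (l : List ι) : List ι :=
  l.takeWhile fun i => decide (α < rk i)

/-- What follows the first letter of rank at most `α` in a word, and the empty word if there is no
such letter. -/
noncomputable def body (α : Ordinal.{0}) (l : List ι) : List ι :=
  (l.dropWhile fun i => decide (α < rk i)).tail

variable {rk}

theorem lt_of_mem_head {α : Ordinal.{0}} {l : List ι} {i : ι} (h : i ∈ head rk α l) :
    α < rk i := by
  simpa using List.mem_takeWhile_imp h

theorem mem_of_mem_head {α : Ordinal.{0}} {l : List ι} {i : ι} (h : i ∈ head rk α l) : i ∈ l :=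
  List.takeWhile_subset _ h

theorem mem_of_mem_body {α : Ordinal.{0}} {l : List ι} {i : ι} (h : i ∈ body rk α l) : i ∈ l :=
  (List.dropWhile_suffix _).subset (List.mem_of_mem_tail h)

theorem length_body_lt {α : Ordinal.{0}} {l : List ι} (h : l ≠ []) :
    (body rk α l).length < l.length := by
  have h1 : (l.dropWhile fun i => decide (α < rk i)).length ≤ l.length :=
    (List.dropWhile_suffix _).length_le
  have h2 := List.length_pos_iff.2 h
  simp only [body, List.length_tail]
  omega

theorem length_head_le (α : Ordinal.{0}) (l : List ι) : (head rk α l).length ≤ l.length :=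
  (List.takeWhile_prefix _).length_le

theorem length_head_lt {α : Ordinal.{0}} {l : List ι} {i : ι} (hi : i ∈ l) (hα : rk i ≤ α) :
    (head rk α l).length < l.length := by
  refine (length_head_le α l).lt_of_ne fun h => ?_
  have := (List.takeWhile_prefix (fun i => decide (α < rk i))).eq_of_length h
  rw [← this] at hi
  exact (lt_of_mem_head hi).not_ge hα

theorem head_eq_self {α : Ordinal.{0}} {l : List ι} (h : ∀ i ∈ l, α < rk i) :
    head rk α l = l :=
  List.takeWhile_eq_self_iff.2 (by simpa using h)

theorem body_eq_nil {α : Ordinal.{0}} {l : List ι} (h : ∀ i ∈ l, α < rk i) :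
    body rk α l = [] := by
  rw [body, List.dropWhile_eq_nil_iff.2 (by simpa using h), List.tail_nil]

variable (rk) in
/-- The least rank of a letter of a word; the value `0` for the empty word is not used. -/
noncomputable def minRank (l : List ι) : Ordinal.{0} :=
  sInf (rk '' {i | i ∈ l})

theorem exists_rk_eq_minRank {l : List ι} (h : l ≠ []) : ∃ i ∈ l, rk i = minRank rk l := by
  obtain ⟨i, hi⟩ := List.exists_mem_of_ne_nil l h
  exact csInf_mem (⟨_, i, hi, rfl⟩ : (rk '' {i | i ∈ l}).Nonempty)

theorem minRank_le {l : List ι} {i : ι} (h : i ∈ l) : minRank rk l ≤ rk i :=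
  csInf_le' ⟨i, h, rfl⟩

variable (rk) in
open Classical in
/-- An upper bound for the order type of the worm `l` with respect to the relation
`B ≺ A ↔ A ⊢ ⟨α⟩ B` on the worms all of whose letters have rank at least `α`. -/
noncomputable def wormRank (α : Ordinal.{0}) (l : List ι) : Ordinal.{0} :=
  if h : l = [] then 0 else
    have : (head rk (minRank rk l) l).length < l.length :=
      let ⟨_, hi, hrk⟩ := exists_rk_eq_minRank (rk := rk) h
      length_head_lt hi hrk.le
    have : (body rk (minRank rk l) l).length < l.length := length_body_lt h
    hyperexp (minRank rk l - α) (wormRank (minRank rk l) (body rk (minRank rk l) l) +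
      ω ^ wormRank (minRank rk l + 1) (head rk (minRank rk l) l))
termination_by l.length

theorem wormRank_nil (α : Ordinal.{0}) : wormRank rk α ([] : List ι) = 0 := by
  rw [wormRank]; simp

theorem wormRank_of_ne_nil (α : Ordinal.{0}) {l : List ι} (h : l ≠ []) :
    wormRank rk α l = hyperexp (minRank rk l - α)
      (wormRank rk (minRank rk l) (body rk (minRank rk l) l) +
        ω ^ wormRank rk (minRank rk l + 1) (head rk (minRank rk l) l)) := by
  rw [wormRank]; simp [h]

/-- Lowering the level at which a nonempty worm is ranked amounts to a hyperexponential. -/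
theorem wormRank_eq_hyperexp {α β : Ordinal.{0}} {l : List ι} (hl : l ≠ []) (hαβ : α ≤ β)
    (h : ∀ i ∈ l, β ≤ rk i) : wormRank rk α l = hyperexp (β - α) (wormRank rk β l) := by
  rw [wormRank_of_ne_nil α hl, wormRank_of_ne_nil β hl, ← hyperexp_add]
  congr 1
  obtain ⟨i, hi, hrk⟩ := exists_rk_eq_minRank (rk := rk) hl
  have hβ : β ≤ minRank rk l := hrk ▸ h i hi
  have h1 : α + (β - α) = β := Ordinal.add_sub_cancel_of_le hαβ
  have h2 : β + (minRank rk l - β) = minRank rk l := Ordinal.add_sub_cancel_of_le hβ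
  conv_lhs => rw [← h2]
  conv_lhs => enter [1, 1]; rw [← h1]
  rw [add_assoc, Ordinal.add_sub_cancel]

/-- The recursion for `wormRank` at any lower bound `α` of the ranks of the letters, attained
or not. -/
theorem wormRank_eq_add {α : Ordinal.{0}} {l : List ι} (hl : l ≠ []) (h : ∀ i ∈ l, α ≤ rk i) :
    wormRank rk α l =
      wormRank rk α (body rk α l) + ω ^ wormRank rk (α + 1) (head rk α l) := by
  by_cases hα : ∀ i ∈ l, α < rk i
  · rw [body_eq_nil hα, head_eq_self hα, wormRank_nil, zero_add,
      wormRank_eq_hyperexp hl (le_self_add : α ≤ α + 1) fun i hi => Order.add_one_le_of_lt (hα i hi),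
      Ordinal.add_sub_cancel, hyperexp_one]
  · push Not at hα
    obtain ⟨j, hj, hjα⟩ := hα
    have hmin : minRank rk l = α := by
      refine ((minRank_le hj).trans hjα).antisymm ?_
      obtain ⟨i, hi, hrk⟩ := exists_rk_eq_minRank (rk := rk) hl
      exact hrk ▸ h i hi
    rw [wormRank_of_ne_nil α hl, hmin, Ordinal.sub_self, hyperexp_zero]

theorem wormRank_body_lt {α : Ordinal.{0}} {l : List ι} (hl : l ≠ []) (h : ∀ i ∈ l, α ≤ rk i) :
    wormRank rk α (body rk α l) < wormRank rk α l := by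
  rw [wormRank_eq_add hl h]
  exact lt_add_of_pos_right _ (opow_pos _ omega0_pos)

theorem wormRank_pos {α : Ordinal.{0}} {l : List ι} (hl : l ≠ []) (h : ∀ i ∈ l, α ≤ rk i) :
    0 < wormRank rk α l :=
  (zero_le (a := _)).trans_lt (wormRank_body_lt hl h)

theorem wormRank_lt_gamma_zero {α : Ordinal.{0}} {l : List ι} (h : ∀ i ∈ l, rk i < gamma 0) :
    wormRank rk α l < gamma 0 := by
  induction hn : l.length using Nat.strong_induction_on generalizing l α with
  | _ n ih =>
    subst hn
    by_cases hl : l = []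
    · subst hl; rw [wormRank_nil]; exact gamma_pos
    · obtain ⟨i, hi, hrk⟩ := exists_rk_eq_minRank (rk := rk) hl
      have hmin : minRank rk l < gamma 0 := hrk ▸ h i hi
      rw [wormRank_of_ne_nil α hl]
      refine hyperexp_lt_gamma_zero ((sub_le_self _ _).trans_lt hmin) (add_lt_gamma_zero ?_ ?_)
      · exact ih _ (length_body_lt hl) (fun i hi => h i (mem_of_mem_body hi)) rfl
      · exact omega0_opow_lt_gamma_zero
          (ih _ (length_head_lt hi hrk.le) (fun i hi => h i (mem_of_mem_head hi)) rfl)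

/-- Comparison of two words through their bodies and heads: the one with the greater head wins,
provided that each exceeds the body of the other. -/
theorem wormRank_lt_wormRank {α : Ordinal.{0}} {l m : List ι} (hl : l ≠ []) (hm : m ≠ [])
    (hlα : ∀ i ∈ l, α ≤ rk i) (hmα : ∀ i ∈ m, α ≤ rk i)
    (hbody : wormRank rk α (body rk α l) < wormRank rk α m)
    (hhead : wormRank rk (α + 1) (head rk α l) < wormRank rk (α + 1) (head rk α m)) :
    wormRank rk α l < wormRank rk α m := by
  rw [wormRank_eq_add hl hlα]
  rw [wormRank_eq_add hm hmα] at hbody ⊢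
  set b := wormRank rk α (body rk α m)
  have hpow := (opow_lt_opow_iff_right one_lt_omega0).2 hhead
  rcases le_total (wormRank rk α (body rk α l)) b with h | h
  · exact (add_le_add_left h _).trans_lt (add_lt_add_right hpow _)
  · rw [← Ordinal.add_sub_cancel_of_le h] at hbody ⊢
    rw [add_assoc]
    exact add_lt_add_right
      (isPrincipal_add_omega0_opow _ (lt_of_add_lt_add_left hbody) hpow) _

/-- With equal heads, the body of `l` is either at most that of `m` or absorbed in the head's
contribution. -/
theorem wormRank_le_wormRank {α : Ordinal.{0}} {l m : List ι} (hl : l ≠ []) (hm : m ≠ [])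
    (hlα : ∀ i ∈ l, α ≤ rk i) (hmα : ∀ i ∈ m, α ≤ rk i)
    (hbody : wormRank rk α (body rk α l) < wormRank rk α m)
    (hhead : wormRank rk (α + 1) (head rk α l) = wormRank rk (α + 1) (head rk α m)) :
    wormRank rk α l ≤ wormRank rk α m := by
  rw [wormRank_eq_add hl hlα, hhead]
  rw [wormRank_eq_add hm hmα] at hbody ⊢
  set b := wormRank rk α (body rk α m)
  rcases le_total (wormRank rk α (body rk α l)) b with h | h
  · exact add_le_add_left h _
  · rw [← Ordinal.add_sub_cancel_of_le h] at hbody ⊢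
    rw [add_assoc, add_omega0_opow (lt_of_add_lt_add_left hbody)]

end Rank

/-! ### Linearity of the consistency ordering -/

/-- A calculus over formulas `F` that satisfies the laws of the reflection calculus for modalities
in `ι`, which are linearly preordered by their ranks. Here `le φ ψ` means `φ ⊢ ψ`. -/
structure ReflectionCalculus (ι : Type*) (F : Type*) where
  /-- Derivability of sequents. -/
  le : F → F → Prop
  /-- Truth. -/
  top : F
  /-- Conjunction. -/
  and : F → F → F
  /-- The modalities. -/
  dia : ι → F → F
  /-- The rank of a modality. -/
  rk : ι → Ordinal.{0}
  refl : ∀ φ, le φ φ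
  cut : ∀ {φ ψ χ}, le φ ψ → le ψ χ → le φ χ
  le_top : ∀ φ, le φ top
  and_left : ∀ φ ψ, le (and φ ψ) φ
  and_right : ∀ φ ψ, le (and φ ψ) ψ
  le_and : ∀ {φ ψ χ}, le φ ψ → le φ χ → le φ (and ψ χ)
  dia_le_dia : ∀ {i j φ ψ}, rk j ≤ rk i → le φ ψ → le (dia i φ) (dia j ψ)
  dia_dia : ∀ i φ, le (dia i (dia i φ)) (dia i φ)
  dia_and : ∀ {i j} φ ψ, rk j < rk i → le (and (dia i φ) (dia j ψ)) (dia i (and φ (dia j ψ)))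

namespace ReflectionCalculus

variable {ι F : Type*} (C : ReflectionCalculus ι F)

/-- The worm with the given modalities. -/
def worm (l : List ι) : F :=
  l.foldr C.dia C.top

variable {C}

theorem dia_dia_le {i j : ι} (h : C.rk j ≤ C.rk i) (φ : F) :
    C.le (C.dia i (C.dia j φ)) (C.dia j φ) :=
  C.cut (C.dia_le_dia h (C.refl _)) (C.dia_dia j φ)

theorem worm_le_head (α : Ordinal.{0}) (l : List ι) :
    C.le (C.worm l) (C.worm (head C.rk α l)) := by
  induction l with
  | nil => exact C.refl _
  | cons i l ih =>
    by_cases h : α < C.rk i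
    · rw [head, List.takeWhile_cons_of_pos (by simpa using h)]
      exact C.dia_le_dia le_rfl ih
    · rw [head, List.takeWhile_cons_of_neg (by simpa using h)]
      exact C.le_top _

/-- The body may be empty because `l` has no letter of the rank of `i`; the claim then is
`l ⊢ ⟨i⟩ ⊤`. -/
theorem worm_le_dia_body {i : ι} {l : List ι} (hl : l ≠ []) (h : ∀ j ∈ l, C.rk i ≤ C.rk j) :
    C.le (C.worm l) (C.dia i (C.worm (body C.rk (C.rk i) l))) := by
  induction l with
  | nil => exact absurd rfl hl
  | cons j l ih =>
    have hj := h j (by simp)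
    by_cases hij : C.rk i < C.rk j
    · by_cases hl' : l = []
      · subst hl'
        rw [body_eq_nil (by simpa using hij)]
        exact C.dia_le_dia hj (C.refl _)
      · have : body C.rk (C.rk i) (j :: l) = body C.rk (C.rk i) l := by
          rw [body, List.dropWhile_cons_of_pos (by simpa using hij), body]
        rw [this]
        exact C.cut (C.dia_le_dia le_rfl (ih hl' fun k hk => h k (by simp [hk])))
          (dia_dia_le hj _)
    · have : body C.rk (C.rk i) (j :: l) = l := by
        rw [body, List.dropWhile_cons_of_neg (by simpa using hij), List.tail_cons]
      rw [this]
      exact C.dia_le_dia hj (C.refl _)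

/-- With `worm_le_head` and `worm_le_dia_body`, a nonempty worm is equivalent to the conjunction of
its head and of `⟨i⟩` applied to its body. -/
theorem head_and_dia_body_le {i : ι} {l : List ι} (h : ∀ j ∈ l, C.rk i ≤ C.rk j) :
    C.le (C.and (C.worm (head C.rk (C.rk i) l)) (C.dia i (C.worm (body C.rk (C.rk i) l))))
      (C.worm l) := by
  induction l with
  | nil => exact C.le_top _
  | cons j l ih =>
    by_cases hij : C.rk i < C.rk j
    · have : body C.rk (C.rk i) (j :: l) = body C.rk (C.rk i) l := by
        rw [body, List.dropWhile_cons_of_pos (by simpa using hij), body]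
      rw [this, head, List.takeWhile_cons_of_pos (by simpa using hij)]
      exact C.cut (C.dia_and _ _ hij)
        (C.dia_le_dia le_rfl (ih fun k hk => h k (by simp [hk])))
    · have : body C.rk (C.rk i) (j :: l) = l := by
        rw [body, List.dropWhile_cons_of_neg (by simpa using hij), List.tail_cons]
      rw [this]
      exact C.cut (C.and_right _ _) (C.dia_le_dia (not_lt.1 hij) (C.refl _))

variable (C) in
/-- `l` is provably below `m` in the ordering given by `⟨i⟩`, and has a smaller rank. -/
def Precedes (i : ι) (l m : List ι) : Prop :=
  C.le (C.worm m) (C.dia i (C.worm l)) ∧ wormRank C.rk (C.rk i) l < wormRank C.rk (C.rk i) m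

variable (C) in
/-- `l` and `m` are provably equivalent and have the same rank. -/
def Equivalent (i : ι) (l m : List ι) : Prop :=
  (C.le (C.worm l) (C.worm m) ∧ C.le (C.worm m) (C.worm l)) ∧
    wormRank C.rk (C.rk i) l = wormRank C.rk (C.rk i) m

theorem Precedes.of_body {i : ι} {l m : List ι} (hm : m ≠ []) (hmi : ∀ k ∈ m, C.rk i ≤ C.rk k)
    (h : C.Precedes i l (body C.rk (C.rk i) m) ∨ C.Equivalent i l (body C.rk (C.rk i) m)) :
    C.Precedes i l m := by
  have h1 := worm_le_dia_body hm hmi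
  have h2 := wormRank_body_lt hm hmi
  rcases h with h | h
  · exact ⟨C.cut h1 (C.cut (C.dia_le_dia le_rfl h.1) (C.dia_dia _ _)), h.2.trans h2⟩
  · exact ⟨C.cut h1 (C.dia_le_dia le_rfl h.1.2), h.2.trans_lt h2⟩

theorem nil_precedes {i : ι} {m : List ι} (hm : m ≠ []) (hmi : ∀ k ∈ m, C.rk i ≤ C.rk k) :
    C.Precedes i [] m :=
  ⟨C.cut (worm_le_dia_body hm hmi) (C.dia_le_dia le_rfl (C.le_top _)),
    wormRank_nil (rk := C.rk) _ ▸ wormRank_pos hm hmi⟩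

theorem wormRank_lt_of_lt {α β : Ordinal.{0}} {l m : List ι} (hαβ : α ≤ β)
    (hl : ∀ k ∈ l, β ≤ C.rk k) (hm : ∀ k ∈ m, β ≤ C.rk k)
    (h : wormRank C.rk β l < wormRank C.rk β m) : wormRank C.rk α l < wormRank C.rk α m := by
  have hm0 : m ≠ [] := by
    rintro rfl
    rw [wormRank_nil] at h
    exact absurd h (zero_le (a := _)).not_gt
  by_cases hl0 : l = []
  · subst hl0
    rw [wormRank_nil]
    exact wormRank_pos hm0 fun k hk => hαβ.trans (hm k hk)
  · rw [wormRank_eq_hyperexp hl0 hαβ hl, wormRank_eq_hyperexp hm0 hαβ hm]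
    exact strictMono_hyperexp _ h

theorem wormRank_eq_of_eq {α β : Ordinal.{0}} {l m : List ι} (hαβ : α ≤ β)
    (hl : ∀ k ∈ l, β ≤ C.rk k) (hm : ∀ k ∈ m, β ≤ C.rk k)
    (h : wormRank C.rk β l = wormRank C.rk β m) : wormRank C.rk α l = wormRank C.rk α m := by
  by_cases hl0 : l = []
  · by_cases hm0 : m = []
    · rw [hl0, hm0]
    · rw [hl0, wormRank_nil] at h
      exact absurd h (wormRank_pos hm0 hm).ne
  · by_cases hm0 : m = []
    · rw [hm0, wormRank_nil] at h
      exact absurd h (wormRank_pos hl0 hl).ne'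
    · rw [wormRank_eq_hyperexp hl0 hαβ hl, wormRank_eq_hyperexp hm0 hαβ hm, h]

theorem Precedes.mono {i j : ι} {l m : List ι} (hij : C.rk i ≤ C.rk j)
    (hl : ∀ k ∈ l, C.rk j ≤ C.rk k) (hm : ∀ k ∈ m, C.rk j ≤ C.rk k) (h : C.Precedes j l m) :
    C.Precedes i l m :=
  ⟨C.cut h.1 (C.dia_le_dia hij (C.refl _)), wormRank_lt_of_lt hij hl hm h.2⟩

theorem Equivalent.mono {i j : ι} {l m : List ι} (hij : C.rk i ≤ C.rk j)
    (hl : ∀ k ∈ l, C.rk j ≤ C.rk k) (hm : ∀ k ∈ m, C.rk j ≤ C.rk k) (h : C.Equivalent j l m) :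
    C.Equivalent i l m :=
  ⟨h.1, wormRank_eq_of_eq hij hl hm h.2⟩

/-- If `j` ranks above `i`, the body of `l` lies below `m` and the head of `l` lies `j`-below the
head of `m`, then `l` lies below `m`: from `m` one derives `⟨j⟩ (head l) ∧ ⟨i⟩ (body l)`, hence
`⟨j⟩ l`. -/
theorem Precedes.of_head {i j : ι} {l m : List ι} (hij : C.rk i < C.rk j) (hl : l ≠ [])
    (hm : m ≠ []) (hli : ∀ k ∈ l, C.rk i ≤ C.rk k) (hmi : ∀ k ∈ m, C.rk i ≤ C.rk k)
    (hlj : ∀ k ∈ head C.rk (C.rk i) l, C.rk j ≤ C.rk k)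
    (hmj : ∀ k ∈ head C.rk (C.rk i) m, C.rk j ≤ C.rk k)
    (hbody : C.Precedes i (body C.rk (C.rk i) l) m)
    (hhead : C.Precedes j (head C.rk (C.rk i) l) (head C.rk (C.rk i) m)) :
    C.Precedes i l m := by
  constructor
  · exact C.cut (C.le_and (C.cut (worm_le_head _ _) hhead.1) hbody.1)
      (C.cut (C.dia_and _ _ hij) (C.dia_le_dia hij.le (head_and_dia_body_le hli)))
  · exact wormRank_lt_wormRank hl hm hli hmi hbody.2
      (wormRank_lt_of_lt (Order.add_one_le_of_lt hij) hlj hmj hhead.2)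

theorem Equivalent.of_head {i : ι} {l m : List ι} (hl : l ≠ [])
    (hm : m ≠ []) (hli : ∀ k ∈ l, C.rk i ≤ C.rk k) (hmi : ∀ k ∈ m, C.rk i ≤ C.rk k)
    (hbody : C.Precedes i (body C.rk (C.rk i) l) m)
    (hbody' : C.Precedes i (body C.rk (C.rk i) m) l)
    (hhead : (C.le (C.worm (head C.rk (C.rk i) l)) (C.worm (head C.rk (C.rk i) m)) ∧
      C.le (C.worm (head C.rk (C.rk i) m)) (C.worm (head C.rk (C.rk i) l))) ∧
      wormRank C.rk (C.rk i + 1) (head C.rk (C.rk i) l) =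
        wormRank C.rk (C.rk i + 1) (head C.rk (C.rk i) m)) :
    C.Equivalent i l m := by
  refine ⟨⟨?_, ?_⟩, (wormRank_le_wormRank hl hm hli hmi hbody.2 hhead.2).antisymm
    (wormRank_le_wormRank hm hl hmi hli hbody'.2 hhead.2.symm)⟩
  · exact C.cut (C.le_and (C.cut (worm_le_head _ _) hhead.1.1) hbody'.1)
      (head_and_dia_body_le hmi)
  · exact C.cut (C.le_and (C.cut (worm_le_head _ _) hhead.1.2) hbody.1)
      (head_and_dia_body_le hli)

/-- Any two worms are comparable, and their ranks compare accordingly. If one of them is not above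
the body of the other, it is below the other; otherwise the heads, whose letters rank above `i`,
decide. -/
theorem precedes_trichotomy {i : ι} {l m : List ι} (hl : ∀ k ∈ l, C.rk i ≤ C.rk k)
    (hm : ∀ k ∈ m, C.rk i ≤ C.rk k) :
    C.Precedes i l m ∨ C.Equivalent i l m ∨ C.Precedes i m l := by
  induction hn : l.length + m.length using Nat.strong_induction_on generalizing i l m with
  | _ n ih =>
  subst hn
  by_cases hl0 : l = []
  · by_cases hm0 : m = []
    · subst hl0 hm0
      exact Or.inr (Or.inl ⟨⟨C.refl _, C.refl _⟩, rfl⟩)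
    · subst hl0
      exact Or.inl (nil_precedes hm0 hm)
  by_cases hm0 : m = []
  · subst hm0
    exact Or.inr (Or.inr (nil_precedes hl0 hl))
  -- It suffices to treat the case in which the rank of `i` is attained.
  have attained : ∀ i : ι, (∀ k ∈ l, C.rk i ≤ C.rk k) → (∀ k ∈ m, C.rk i ≤ C.rk k) →
      (∃ k ∈ l ++ m, C.rk k ≤ C.rk i) →
      C.Precedes i l m ∨ C.Equivalent i l m ∨ C.Precedes i m l := by
    clear hl hm i
    intro i hl hm ⟨k, hk, hki⟩
    have lb := length_body_lt (rk := C.rk) (α := C.rk i) hl0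
    have mb := length_body_lt (rk := C.rk) (α := C.rk i) hm0
    have hml : C.Precedes i (body C.rk (C.rk i) m) l ∨ C.Precedes i l m := by
      rcases ih (l.length + (body C.rk (C.rk i) m).length) (by omega) hl
        (fun k hk => hm k (mem_of_mem_body hk)) rfl with h | h | h
      · exact Or.inr (.of_body hm0 hm (Or.inl h))
      · exact Or.inr (.of_body hm0 hm (Or.inr h))
      · exact Or.inl h
    have hlm : C.Precedes i (body C.rk (C.rk i) l) m ∨ C.Precedes i m l := by
      rcases ih (m.length + (body C.rk (C.rk i) l).length) (by omega) hm
        (fun k hk => hl k (mem_of_mem_body hk)) rfl with h | h | h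
      · exact Or.inr (.of_body hl0 hl (Or.inl h))
      · exact Or.inr (.of_body hl0 hl (Or.inr h))
      · exact Or.inl h
    rcases hml with hml | h
    swap
    · exact Or.inl h
    rcases hlm with hlm | h
    swap
    · exact Or.inr (Or.inr h)
    have hlen : (head C.rk (C.rk i) l).length + (head C.rk (C.rk i) m).length <
        l.length + m.length := by
      have h1 := length_head_le (rk := C.rk) (C.rk i) l
      have h2 := length_head_le (rk := C.rk) (C.rk i) m
      rcases List.mem_append.1 hk with hk | hk
      · have := length_head_lt hk hki
        omega
      · have := length_head_lt hk hki
        omega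
    by_cases hnil : head C.rk (C.rk i) l ++ head C.rk (C.rk i) m = []
    · obtain ⟨h1, h2⟩ := List.append_eq_nil_iff.1 hnil
      refine Or.inr (Or.inl (.of_head hl0 hm0 hl hm hlm hml ?_))
      rw [h1, h2]
      exact ⟨⟨C.refl _, C.refl _⟩, rfl⟩
    · obtain ⟨j, hj, hjmin⟩ := exists_rk_eq_minRank (rk := C.rk) hnil
      have hij : C.rk i < C.rk j := by
        rcases List.mem_append.1 hj with hj | hj <;> exact lt_of_mem_head hj
      have hlj : ∀ k ∈ head C.rk (C.rk i) l, C.rk j ≤ C.rk k := fun k hk =>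
        hjmin ▸ minRank_le (List.mem_append_left _ hk)
      have hmj : ∀ k ∈ head C.rk (C.rk i) m, C.rk j ≤ C.rk k := fun k hk =>
        hjmin ▸ minRank_le (List.mem_append_right _ hk)
      rcases ih _ hlen hlj hmj rfl with h | h | h
      · exact Or.inl (.of_head hij hl0 hm0 hl hm hlj hmj hlm h)
      · exact Or.inr (Or.inl (.of_head hl0 hm0 hl hm hlm hml
          ⟨h.1, wormRank_eq_of_eq (Order.add_one_le_of_lt hij) hlj hmj h.2⟩))
      · exact Or.inr (Or.inr (.of_head hij hm0 hl0 hm hl hmj hlj hml h))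
  obtain ⟨j, hj, hjmin⟩ := exists_rk_eq_minRank (rk := C.rk) (l := l ++ m) (by simp [hl0])
  have hlj : ∀ k ∈ l, C.rk j ≤ C.rk k := fun k hk =>
    hjmin ▸ minRank_le (List.mem_append_left _ hk)
  have hmj : ∀ k ∈ m, C.rk j ≤ C.rk k := fun k hk =>
    hjmin ▸ minRank_le (List.mem_append_right _ hk)
  have hij : C.rk i ≤ C.rk j := by
    rcases List.mem_append.1 hj with hj | hj
    · exact hl j hj
    · exact hm j hj
  rcases attained j hlj hmj ⟨j, hj, le_rfl⟩ with h | h | h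
  · exact Or.inl (h.mono hij hlj hmj)
  · exact Or.inr (Or.inl (h.mono hij hlj hmj))
  · exact Or.inr (Or.inr (h.mono hij hmj hlj))

end ReflectionCalculus

/-! ### Irreflexivity of the consistency ordering -/

/-- The least multiple of `ω ^ a` above `x`. -/
noncomputable def nextMultiple (a x : Ordinal.{0}) : Ordinal.{0} :=
  ω ^ a * (x / ω ^ a + 1)

open Classical in
/-- The least multiple of `ω ^ a` that is at least `x`. -/
noncomputable def roundUp (a x : Ordinal.{0}) : Ordinal.{0} :=
  if ω ^ a ∣ x then x else nextMultiple a x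

theorem dvd_nextMultiple (a x : Ordinal.{0}) : ω ^ a ∣ nextMultiple a x :=
  Dvd.intro _ rfl

theorem lt_nextMultiple (a x : Ordinal.{0}) : x < nextMultiple a x :=
  lt_mul_succ_div x (opow_pos a omega0_pos).ne'

theorem nextMultiple_le {a x y : Ordinal.{0}} (hy : ω ^ a ∣ y) (hxy : x < y) :
    nextMultiple a x ≤ y := by
  obtain ⟨c, rfl⟩ := hy
  have h := (lt_mul_iff_div_lt (opow_pos a omega0_pos).ne').1 hxy
  exact mul_le_mul_right (Order.add_one_le_of_lt h) _

/-- The quotient of `nextMultiple a x` by `ω ^ a` is a successor, hence not a multiple of `ω`. -/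
theorem not_dvd_nextMultiple {a b : Ordinal.{0}} (hab : a < b) (x : Ordinal.{0}) :
    ¬ ω ^ b ∣ nextMultiple a x := by
  rintro ⟨c, hc⟩
  rw [← Ordinal.add_sub_cancel_of_le (Order.add_one_le_of_lt hab), opow_add, opow_add, opow_one,
    nextMultiple, mul_assoc, mul_assoc] at hc
  have hdvd := Dvd.intro _ (mul_left_cancel₀ (opow_pos a omega0_pos).ne' hc).symm
  rw [← isSuccPrelimit_iff_omega0_dvd] at hdvd
  exact hdvd _ (Order.covBy_add_one _)

theorem nextMultiple_lt {a b x y : Ordinal.{0}} (hab : a < b) (hy : ω ^ b ∣ y) (hxy : x < y) :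
    nextMultiple a x < y :=
  (nextMultiple_le ((opow_dvd_opow ω hab.le).trans hy) hxy).lt_of_ne fun h =>
    not_dvd_nextMultiple hab x (h ▸ hy)

theorem dvd_roundUp (a x : Ordinal.{0}) : ω ^ a ∣ roundUp a x := by
  rw [roundUp]
  split_ifs with h
  · exact h
  · exact dvd_nextMultiple a x

theorem le_roundUp (a x : Ordinal.{0}) : x ≤ roundUp a x := by
  rw [roundUp]
  split_ifs
  · exact le_rfl
  · exact (lt_nextMultiple a x).le

theorem roundUp_le {a x y : Ordinal.{0}} (hy : ω ^ a ∣ y) (hxy : x ≤ y) : roundUp a x ≤ y := by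
  rw [roundUp]
  split_ifs with h
  · exact hxy
  · exact nextMultiple_le hy (hxy.lt_of_ne fun e => h (e ▸ hy))

theorem roundUp_lt {a b x y : Ordinal.{0}} (hab : a < b) (hy : ω ^ b ∣ y) (hxy : x < y) :
    roundUp a x < y := by
  rw [roundUp]
  split_ifs
  · exact hxy
  · exact nextMultiple_lt hab hy hxy

/-- An algebraic model of the reflection calculus with modalities in `S`, in which every `⟨α⟩`
increases an ordinal rank `o` that is antitone. -/
structure RankedAlgebra (S : Set Ordinal.{0}) (M : Type*) [SemilatticeInf M] where
  /-- The modalities; those outside `S` are subject only to monotonicity. -/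
  dia : Ordinal.{0} → M → M
  /-- The rank of an element. -/
  o : M → Ordinal.{0}
  o_antitone : Antitone o
  o_lt_o_dia : ∀ {α}, α ∈ S → ∀ x, o x < o (dia α x)
  dia_mono : ∀ α, Monotone (dia α)
  dia_dia : ∀ {α}, α ∈ S → ∀ x, dia α (dia α x) ≤ dia α x
  dia_le_dia : ∀ {α β}, α ∈ S → β ∈ S → β < α → ∀ x, dia α x ≤ dia β x
  dia_inf : ∀ {α β}, α ∈ S → β ∈ S → β < α → ∀ x y,
    dia α x ⊓ dia β y ≤ dia α (x ⊓ dia β y)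

namespace RankedAlgebra

variable {S T : Set Ordinal.{0}} {M : Type*} [SemilatticeInf M]

/-- A model for `T` is a model for every subset of `T`. -/
def restrict (A : RankedAlgebra T M) (h : S ⊆ T) : RankedAlgebra S M where
  dia := A.dia
  o := A.o
  o_antitone := A.o_antitone
  o_lt_o_dia hα := A.o_lt_o_dia (h hα)
  dia_mono := A.dia_mono
  dia_dia hα := A.dia_dia (h hα)
  dia_le_dia hα hβ := A.dia_le_dia (h hα) (h hβ)
  dia_inf hα hβ := A.dia_inf (h hα) (h hβ)

/-- Pairs of an element `m` of a ranked algebra and a multiple of `ω ^ o m`. -/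
@[ext]
structure Extension (A : RankedAlgebra S M) where
  /-- The new rank. -/
  rank : Ordinal.{0}
  /-- The underlying element. -/
  elt : M
  dvd : ω ^ A.o elt ∣ rank

namespace Extension

variable {A : RankedAlgebra S M}

/-- A pair is stronger if its rank is greater and its element is stronger. -/
instance : PartialOrder A.Extension where
  le p q := q.rank ≤ p.rank ∧ p.elt ≤ q.elt
  le_refl p := ⟨le_rfl, le_rfl⟩
  le_trans p q r hpq hqr := ⟨hqr.1.trans hpq.1, hpq.2.trans hqr.2⟩
  le_antisymm p q hpq hqp := Extension.ext (hqp.1.antisymm hpq.1) (hpq.2.antisymm hqp.2)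

noncomputable instance : SemilatticeInf A.Extension where
  inf p q := ⟨roundUp (A.o (p.elt ⊓ q.elt)) (max p.rank q.rank), p.elt ⊓ q.elt, dvd_roundUp _ _⟩
  inf_le_left _ _ := ⟨(le_max_left _ _).trans (le_roundUp _ _), inf_le_left⟩
  inf_le_right _ _ := ⟨(le_max_right _ _).trans (le_roundUp _ _), inf_le_right⟩
  le_inf p _ _ hpq hpr := ⟨roundUp_le
    ((opow_dvd_opow ω (A.o_antitone (le_inf hpq.2 hpr.2))).trans p.dvd)
    (max_le hpq.1 hpr.1), le_inf hpq.2 hpr.2⟩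

instance [OrderTop M] : OrderTop A.Extension where
  top := ⟨0, ⊤, dvd_zero _⟩
  le_top _ := ⟨zero_le (a := _), le_top⟩

theorem rank_inf (p q : A.Extension) :
    (p ⊓ q).rank = roundUp (A.o (p.elt ⊓ q.elt)) (max p.rank q.rank) := rfl

theorem elt_inf (p q : A.Extension) : (p ⊓ q).elt = p.elt ⊓ q.elt := rfl

end Extension

variable [OrderTop M]

open Classical in
/-- The modalities of `A`, with those outside `S` made trivial. -/
noncomputable def trivDia (A : RankedAlgebra S M) (α : Ordinal.{0}) (x : M) : M :=
  if α ∈ S then A.dia α x else ⊤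

/-- If `A` is a model for `S` and `a` is below all elements of `S`, then the pairs `(ξ, m)` form
a model for `S ∪ {a}`: every modality `⟨α⟩` moves the rank `ξ` to the next multiple of the
appropriate power of `ω`, and `⟨a⟩` forgets `m`. -/
noncomputable def extend (A : RankedAlgebra S M) (a : Ordinal.{0}) (ha : ∀ α ∈ S, a < α) :
    RankedAlgebra (insert a S) A.Extension where
  dia α p := ⟨nextMultiple (A.o (A.trivDia α p.elt)) p.rank, A.trivDia α p.elt,
    dvd_nextMultiple _ _⟩
  o := Extension.rank
  o_antitone _ _ h := h.1
  o_lt_o_dia _ _ := lt_nextMultiple _ _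
  dia_mono α p q h := by
    have hd : A.trivDia α p.elt ≤ A.trivDia α q.elt := by
      unfold trivDia
      split_ifs
      · exact A.dia_mono α h.2
      · exact le_rfl
    exact ⟨nextMultiple_le ((opow_dvd_opow ω (A.o_antitone hd)).trans (dvd_nextMultiple _ _))
      (h.1.trans_lt (lt_nextMultiple _ _)), hd⟩
  dia_dia {α} hα p := by
    refine ⟨(lt_nextMultiple _ _).le, ?_⟩
    simp only [trivDia]
    split_ifs with h
    · exact A.dia_dia h _
    · exact le_rfl
  dia_le_dia {α β} hα hβ hβα p := by
    have hd : A.trivDia α p.elt ≤ A.trivDia β p.elt := by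
      by_cases h : β ∈ S
      · have hαS : α ∈ S := hα.resolve_left ((ha β h).trans hβα).ne'
        simp only [trivDia, h, hαS, if_true]
        exact A.dia_le_dia hαS h hβα _
      · simp [trivDia, h]
    exact ⟨nextMultiple_le ((opow_dvd_opow ω (A.o_antitone hd)).trans (dvd_nextMultiple _ _))
      (lt_nextMultiple _ _), hd⟩
  dia_inf {α β} hα hβ hβα p q := by
    have hαS : α ∈ S := by
      refine hα.resolve_left ?_
      rintro rfl
      rcases hβ with rfl | hβ
      · exact hβα.false
      · exact (ha β hβ).not_gt hβα
    have hd : A.trivDia α p.elt ⊓ A.trivDia β q.elt ≤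
        A.trivDia α (p.elt ⊓ A.trivDia β q.elt) := by
      by_cases h : β ∈ S
      · simp only [trivDia, h, hαS, if_true]
        exact A.dia_inf hαS h hβα _ _
      · simp [trivDia, h]
    have ho : A.o (p.elt ⊓ A.trivDia β q.elt) <
        A.o (A.trivDia α (p.elt ⊓ A.trivDia β q.elt)) := by
      simp only [trivDia, hαS, if_true]
      exact A.o_lt_o_dia hαS _
    refine ⟨?_, hd⟩
    simp only [Extension.rank_inf, Extension.elt_inf]
    have hle := le_roundUp (A.o (A.trivDia α p.elt ⊓ A.trivDia β q.elt))
      (max (nextMultiple (A.o (A.trivDia α p.elt)) p.rank)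
        (nextMultiple (A.o (A.trivDia β q.elt)) q.rank))
    have hdvd := (opow_dvd_opow ω (A.o_antitone hd)).trans
      (dvd_roundUp (A.o (A.trivDia α p.elt ⊓ A.trivDia β q.elt))
        (max (nextMultiple (A.o (A.trivDia α p.elt)) p.rank)
          (nextMultiple (A.o (A.trivDia β q.elt)) q.rank)))
    -- The left-hand rank is a multiple of a power of `ω` so large that it cannot be reached
    -- from below by rounding up to multiples of smaller powers.
    refine nextMultiple_le hdvd (roundUp_lt ho hdvd (max_lt ?_ ?_))
    · exact (lt_nextMultiple _ _).trans_le ((le_max_left _ _).trans hle)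
    · exact nextMultiple_lt ((A.o_antitone inf_le_right).trans_lt ho) hdvd
        ((lt_nextMultiple _ _).trans_le ((le_max_right _ _).trans hle))

/-- The modalities of `S` are added from the greatest down, starting from a one-point model. -/
theorem exists_rankedAlgebra (S : Finset Ordinal.{0}) :
    ∃ (M : Type 1) (_ : SemilatticeInf M) (_ : OrderTop M),
      Nonempty (RankedAlgebra (S : Set Ordinal.{0}) M) := by
  induction S using Finset.induction_on_min with
  | empty =>
    refine ⟨PUnit, inferInstance, inferInstance, ⟨?_⟩⟩
    exact {
      dia := fun _ x => x
      o := fun _ => 0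
      o_antitone := fun _ _ _ => le_rfl
      o_lt_o_dia := by simp
      dia_mono := fun _ => monotone_id
      dia_dia := by simp
      dia_le_dia := by simp
      dia_inf := by simp }
  | insert a S ha ih =>
    obtain ⟨M, _, _, ⟨A⟩⟩ := ih
    refine ⟨A.Extension, inferInstance, inferInstance, ?_⟩
    rw [Finset.coe_insert]
    exact ⟨A.extend a ha⟩

/-- The value of a formula in a model, where variables are interpreted as true. -/
def eval {V : Type u} (A : RankedAlgebra S M) : RCFormula V → M
  | .top => ⊤
  | .var _ => ⊤
  | .and φ ψ => A.eval φ ⊓ A.eval ψ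
  | .dia α φ => A.dia α (A.eval φ)

theorem eval_restrict {V : Type u} (A : RankedAlgebra T M) (h : S ⊆ T) (φ : RCFormula V) :
    (A.restrict h).eval φ = A.eval φ := by
  induction φ with
  | top => rfl
  | var _ => rfl
  | and _ _ ih₁ ih₂ => simp only [eval, ih₁, ih₂]
  | dia α _ ih => exact congrArg (A.dia α) ih

/-- Soundness passes to models for larger sets of modalities. -/
theorem eval_le_eval_of_subset {V : Type u} {φ ψ : RCFormula V}
    (hS : ∀ A : RankedAlgebra S M, A.eval φ ≤ A.eval ψ) (h : S ⊆ T) (A : RankedAlgebra T M) :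
    A.eval φ ≤ A.eval ψ := by
  simpa only [eval_restrict] using hS (A.restrict h)

end RankedAlgebra

/-- A derivation uses finitely many modalities, and is sound in all models for these. -/
theorem RC.exists_sound {V : Type u} {Λ : Ordinal.{0}} {φ ψ : RCFormula V} (h : RC Λ φ ψ) :
    ∃ S : Finset Ordinal.{0}, ∀ (M : Type 1) [SemilatticeInf M] [OrderTop M]
      (A : RankedAlgebra (S : Set Ordinal.{0}) M), A.eval φ ≤ A.eval ψ := by
  classical
  induction h with
  | refl _ => exact ⟨∅, fun M _ _ A => le_rfl⟩
  | top _ => exact ⟨∅, fun M _ _ A => le_top⟩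
  | and_left _ _ => exact ⟨∅, fun M _ _ A => inf_le_left⟩
  | and_right _ _ => exact ⟨∅, fun M _ _ A => inf_le_right⟩
  | @dia_dia α _ _ _ => exact ⟨{α}, fun M _ _ A => A.dia_dia (by simp) _⟩
  | @dia_mono α β _ _ hβα _ =>
    exact ⟨{α, β}, fun M _ _ A => A.dia_le_dia (by simp) (by simp) hβα _⟩
  | @dia_and α β _ _ _ hβα _ _ =>
    exact ⟨{α, β}, fun M _ _ A => A.dia_inf (by simp) (by simp) hβα _ _⟩
  | and_intro _ _ ih₁ ih₂ =>
    obtain ⟨S, hS⟩ := ih₁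
    obtain ⟨T, hT⟩ := ih₂
    exact ⟨S ∪ T, fun M _ _ A => le_inf
      (RankedAlgebra.eval_le_eval_of_subset (hS M) (by simp) A)
      (RankedAlgebra.eval_le_eval_of_subset (hT M) (by simp) A)⟩
  | cut _ _ ih₁ ih₂ =>
    obtain ⟨S, hS⟩ := ih₁
    obtain ⟨T, hT⟩ := ih₂
    exact ⟨S ∪ T, fun M _ _ A =>
      (RankedAlgebra.eval_le_eval_of_subset (hS M) (by simp) A).trans
        (RankedAlgebra.eval_le_eval_of_subset (hT M) (by simp) A)⟩
  | @dia_congr α _ _ _ _ ih =>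
    obtain ⟨S, hS⟩ := ih
    exact ⟨S, fun M _ _ A => A.dia_mono α (hS M A)⟩

/-- In a model in which `⟨α⟩` increases the rank, `φ ⊢ ⟨α⟩ φ` would make the rank of `φ` exceed
itself. -/
theorem RC.not_dia_self {V : Type u} {Λ α : Ordinal.{0}} {φ : RCFormula V} :
    ¬ RC Λ φ (.dia α φ) := by
  classical
  intro h
  obtain ⟨S, hS⟩ := h.exists_sound
  obtain ⟨M, _, _, ⟨A⟩⟩ := RankedAlgebra.exists_rankedAlgebra (insert α S)
  exact (A.o_lt_o_dia (α := α) (by simp) (A.eval φ)).not_ge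
    (A.o_antitone (RankedAlgebra.eval_le_eval_of_subset (hS M) (by simp) A))

/-! ### Well-foundedness and order types -/

section OrderType

variable {V : Type u} {Λ : Ordinal.{0}}

theorem top_mem_lang : (.top : RCFormula V) ∈ lang V Λ := by
  simp [lang, RCFormula.signature]

theorem var_mem_lang (p : V) : .var p ∈ lang V Λ := by
  simp [lang, RCFormula.signature]

theorem and_mem_lang {φ ψ : RCFormula V} :
    .and φ ψ ∈ lang V Λ ↔ φ ∈ lang V Λ ∧ ψ ∈ lang V Λ := by
  simp [lang, RCFormula.signature, or_imp, forall_and]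

theorem dia_mem_lang {α : Ordinal.{0}} {φ : RCFormula V} :
    .dia α φ ∈ lang V Λ ↔ α < Λ ∧ φ ∈ lang V Λ := by
  simp [lang, RCFormula.signature]

theorem IsWorm.mem_lang {A : RCFormula V} (h : IsWorm Λ A) : A ∈ lang V Λ := by
  induction h with
  | top => exact top_mem_lang
  | dia hα _ ih => exact dia_mem_lang.2 ⟨hα, ih⟩

theorem RC.dia_le_dia {α β : Ordinal.{0}} {φ ψ : RCFormula V} (hα : α < Λ) (hβα : β ≤ α)
    (hψ : ψ ∈ lang V Λ) (h : RC Λ φ ψ) : RC Λ (.dia α φ) (.dia β ψ) := by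
  rcases hβα.eq_or_lt with rfl | hβα
  · exact .dia_congr hα h
  · exact .cut (.dia_congr hα h) (.dia_mono hα hβα hψ)

variable (V Λ) in
/-- The calculus `RC_Λ`, each modality `⟨α⟩` having rank `α`. -/
def rcCalculus : ReflectionCalculus (Set.Iio Λ) {φ : RCFormula V // φ ∈ lang V Λ} where
  le φ ψ := RC Λ φ.1 ψ.1
  top := ⟨.top, top_mem_lang⟩
  and φ ψ := ⟨.and φ.1 ψ.1, and_mem_lang.2 ⟨φ.2, ψ.2⟩⟩
  dia α φ := ⟨.dia α.1 φ.1, dia_mem_lang.2 ⟨α.2, φ.2⟩⟩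
  rk := Subtype.val
  refl φ := .refl φ.2
  cut := .cut
  le_top φ := .top φ.2
  and_left φ ψ := .and_left φ.2 ψ.2
  and_right φ ψ := .and_right φ.2 ψ.2
  le_and := .and_intro
  dia_le_dia {α _ _ ψ} h h' := .dia_le_dia α.2 h ψ.2 h'
  dia_dia α φ := .dia_dia α.2 φ.2
  dia_and {α _} φ ψ h := .dia_and α.2 h φ.2 ψ.2

open Classical in
/-- The sequence of the modalities of a worm. On other formulas the value is of no significance. -/
noncomputable def modalities (Λ : Ordinal.{0}) : RCFormula V → List (Set.Iio Λ)
  | .dia α φ => if h : α < Λ then ⟨α, h⟩ :: modalities Λ φ else []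
  | _ => []

theorem IsWorm.worm_modalities {A : RCFormula V} (h : IsWorm Λ A) :
    ((rcCalculus V Λ).worm (modalities Λ A)).1 = A := by
  induction h with
  | top => rfl
  | @dia α A hα _ ih =>
    rw [modalities, dif_pos hα]
    exact congrArg (RCFormula.dia α) ih

/-- The rank of a worm of `𝕎_Λ` at level `0`. -/
noncomputable def RCFormula.rank (Λ : Ordinal.{0}) (A : RCFormula V) : Ordinal.{0} :=
  wormRank (Subtype.val : Set.Iio Λ → Ordinal.{0}) 0 (modalities Λ A)

theorem WormLT.rank_lt {A B : RCFormula V} (hΛ : 0 < Λ) (h : WormLT Λ B A) :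
    B.rank Λ < A.rank Λ := by
  obtain ⟨hB, hA, hBA⟩ := h
  rcases (rcCalculus V Λ).precedes_trichotomy (i := ⟨0, hΛ⟩) (l := modalities Λ B)
    (m := modalities Λ A) (fun _ _ => zero_le (a := _)) (fun _ _ => zero_le (a := _))
    with h | h | h
  · exact h.2
  · have h' := h.1.1
    change RC Λ ((rcCalculus V Λ).worm _).1 ((rcCalculus V Λ).worm _).1 at h'
    rw [hA.worm_modalities, hB.worm_modalities] at h'
    exact absurd (hBA.cut (.dia_congr hΛ h')) RC.not_dia_self
  · have h' := h.1
    change RC Λ ((rcCalculus V Λ).worm _).1 (.dia 0 ((rcCalculus V Λ).worm _).1) at h'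
    rw [hA.worm_modalities, hB.worm_modalities] at h'
    exact absurd ((hBA.cut (.dia_congr hΛ h')).cut (.dia_dia hΛ hA.mem_lang)) RC.not_dia_self

theorem wellFounded_wormLT (hΛ : 0 < Λ) : WellFounded (WormLT (V := V) Λ) :=
  Subrelation.wf (fun h => h.rank_lt hΛ) (InvImage.wf (RCFormula.rank Λ) wellFounded_lt)

theorem WormLT.orderType_lt {A B : RCFormula V} (hΛ : 0 < Λ) (h : WormLT Λ B A) :
    orderType Λ B < orderType Λ A := by
  rw [orderType_eq Λ (wellFounded_wormLT hΛ) A, ← Order.add_one_le_iff]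
  exact Ordinal.le_iSup (fun B : {B : RCFormula V // WormLT Λ B A} => orderType Λ B.1 + 1) ⟨B, h⟩

theorem orderType_le_rank (hΛ : 0 < Λ) (A : RCFormula V) : orderType Λ A ≤ A.rank Λ := by
  induction A using (wellFounded_wormLT hΛ).induction with
  | _ A ih =>
    rw [orderType_eq Λ (wellFounded_wormLT hΛ) A]
    exact Ordinal.iSup_le fun B =>
      Order.add_one_le_of_lt ((ih B.1 B.2).trans_lt (B.2.rank_lt hΛ))

theorem orderType_mono (hΛ : 0 < Λ) {A B : RCFormula V} (hA : IsWorm Λ A) (h : RC Λ A B) :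
    orderType Λ B ≤ orderType Λ A := by
  rw [orderType_eq Λ (wellFounded_wormLT hΛ) B]
  exact Ordinal.iSup_le fun C => Order.add_one_le_of_lt
    (WormLT.orderType_lt hΛ ⟨C.2.1, hA, h.cut C.2.2.2⟩)

theorem orderType_top (hΛ : 0 < Λ) : orderType Λ (.top : RCFormula V) = 0 := by
  refine le_antisymm ((orderType_le_rank hΛ _).trans_eq ?_) (zero_le (a := _))
  simp [RCFormula.rank, modalities, wormRank_nil]

theorem orderType_lt_gamma_zero (A : RCFormula V) :
    orderType (gamma 0) A < gamma 0 :=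
  (orderType_le_rank gamma_pos A).trans_lt (wormRank_lt_gamma_zero fun i _ => i.2)

theorem oStar_lt_gamma_zero (a : BracketWorm) : a.oStar V < gamma 0 :=
  orderType_lt_gamma_zero _

theorem isWorm_star (a : BracketWorm) : IsWorm (gamma 0) (a.star V) := by
  induction a with
  | top => exact .top
  | br a b _ ih => exact .dia (oStar_lt_gamma_zero a) ih

theorem tau_mem_lang (φ : BCFormula V) : φ.tau ∈ lang V (gamma 0) := by
  induction φ with
  | top => exact top_mem_lang
  | var p => exact var_mem_lang p
  | and _ _ ih₁ ih₂ => exact and_mem_lang.2 ⟨ih₁, ih₂⟩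
  | br a _ ih => exact dia_mem_lang.2 ⟨oStar_lt_gamma_zero a, ih⟩

end OrderType

/-! ### Soundness of the translation and linearity of the bracket calculus -/

section Bracket

variable {V : Type u}

theorem tau_toFormula (a : BracketWorm) : (a.toFormula : BCFormula V).tau = a.star V := by
  induction a with
  | top => rfl
  | br a b _ ih => exact congrArg (RCFormula.dia _) ih

theorem oStar_top : BracketWorm.top.oStar V = 0 :=
  orderType_top gamma_pos

theorem oStar_lt_of_rc {a b : BracketWorm}
    (h : RC (gamma 0) (a.toFormula : BCFormula V).tau (BCFormula.br .top b.toFormula).tau) :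
    b.oStar V < a.oStar V := by
  rw [BCFormula.tau, tau_toFormula, tau_toFormula, oStar_top] at h
  exact WormLT.orderType_lt gamma_pos ⟨isWorm_star b, isWorm_star a, h⟩

theorem oStar_le_of_rc {a b : BracketWorm}
    (h : RC (gamma 0) (a.toFormula : BCFormula V).tau b.toFormula.tau) :
    b.oStar V ≤ a.oStar V := by
  rw [tau_toFormula, tau_toFormula] at h
  exact orderType_mono gamma_pos (isWorm_star a) h

theorem BC.rc_tau {φ ψ : BCFormula V} (h : BC φ ψ) : RC (gamma 0) φ.tau ψ.tau := by
  have br_br {φ ψ : BCFormula V} {a b : BracketWorm} (hab : b.oStar V ≤ a.oStar V)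
      (h : RC (gamma 0) φ.tau ψ.tau) :
      RC (gamma 0) (BCFormula.br a (.br b φ)).tau (BCFormula.br b ψ).tau :=
    ((RC.dia_le_dia (oStar_lt_gamma_zero a) hab (tau_mem_lang (.br b φ))
      (.refl (tau_mem_lang _))).cut (.dia_dia (oStar_lt_gamma_zero b) (tau_mem_lang φ))).cut
      (.dia_congr (oStar_lt_gamma_zero b) h)
  induction h with
  | refl φ => exact .refl (tau_mem_lang φ)
  | top φ => exact .top (tau_mem_lang φ)
  | and_left φ ψ => exact .and_left (tau_mem_lang φ) (tau_mem_lang ψ)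
  | and_right φ ψ => exact .and_right (tau_mem_lang φ) (tau_mem_lang ψ)
  | and_intro _ _ ih₁ ih₂ => exact .and_intro ih₁ ih₂
  | cut _ _ ih₁ ih₂ => exact .cut ih₁ ih₂
  | br_lt _ _ ih₁ ih₂ =>
    exact .dia_le_dia (oStar_lt_gamma_zero _) (oStar_lt_of_rc ih₂).le (tau_mem_lang _) ih₁
  | br_le _ _ ih₁ ih₂ =>
    exact .dia_le_dia (oStar_lt_gamma_zero _) (oStar_le_of_rc ih₂) (tau_mem_lang _) ih₁
  | br_br_lt _ _ ih₁ ih₂ => exact br_br (oStar_lt_of_rc ih₂).le ih₁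
  | br_br_le _ _ ih₁ ih₂ => exact br_br (oStar_le_of_rc ih₂) ih₁
  | br_and _ ih =>
    exact .dia_and (oStar_lt_gamma_zero _) (oStar_lt_of_rc ih) (tau_mem_lang _) (tau_mem_lang _)

variable (V) in
/-- The bracket notations `a` and `b` are comparable in the bracket calculus. -/
def Comparable (a b : BracketWorm) : Prop :=
  BC (b.toFormula : BCFormula V) (.br .top a.toFormula) ∨
    (BC (a.toFormula : BCFormula V) b.toFormula ∧ BC (b.toFormula : BCFormula V) a.toFormula) ∨
    BC (a.toFormula : BCFormula V) (.br .top b.toFormula)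

theorem Comparable.bc_of_lt {a b : BracketWorm} (h : Comparable V a b)
    (hab : b.oStar V < a.oStar V) : BC (a.toFormula : BCFormula V) (.br .top b.toFormula) := by
  rcases h with h | h | h
  · exact absurd (oStar_lt_of_rc h.rc_tau) hab.not_gt
  · exact absurd (oStar_le_of_rc h.2.rc_tau) hab.not_ge
  · exact h

theorem Comparable.bc_of_eq {a b : BracketWorm} (h : Comparable V a b)
    (hab : b.oStar V = a.oStar V) : BC (a.toFormula : BCFormula V) b.toFormula := by
  rcases h with h | h | h
  · exact absurd (oStar_lt_of_rc h.rc_tau) hab.not_gt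
  · exact h.1
  · exact absurd (oStar_lt_of_rc h.rc_tau) hab.not_lt

theorem Comparable.br_le_br {a b : BracketWorm} (h : Comparable V a b)
    (hab : b.oStar V ≤ a.oStar V) {φ ψ : BCFormula V} (hφψ : BC φ ψ) :
    BC (.br a φ) (.br b ψ) := by
  rcases hab.lt_or_eq with hab | hab
  · exact .br_lt hφψ (h.bc_of_lt hab)
  · exact .br_le hφψ (h.bc_of_eq hab)

/-- The bracket calculus with its modalities restricted to pairwise comparable ones. -/
noncomputable def bcCalculus (S : Set BracketWorm) (hS : ∀ a ∈ S, ∀ b ∈ S, Comparable V a b) :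
    ReflectionCalculus S (BCFormula V) where
  le := BC
  top := .top
  and := .and
  dia a φ := .br a.1 φ
  rk a := a.1.oStar V
  refl := .refl
  cut := .cut
  le_top := .top
  and_left := .and_left
  and_right := .and_right
  le_and := .and_intro
  dia_le_dia {a b _ _} h h' := (hS a.1 a.2 b.1 b.2).br_le_br h h'
  dia_dia _ φ := .br_br_le (.refl φ) (.refl _)
  dia_and {a b} _ _ h := .br_and ((hS a.1 a.2 b.1 b.2).bc_of_lt h)

theorem exists_worm_eq_toFormula {S : Set BracketWorm}
    (hS : ∀ a ∈ S, ∀ b ∈ S, Comparable V a b) {a : BracketWorm}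
    (ha : ∀ c, sizeOf c < sizeOf a → c ∈ S) :
    ∃ l, (bcCalculus S hS).worm l = a.toFormula := by
  induction a with
  | top => exact ⟨[], rfl⟩
  | br a b _ ih =>
    simp only [BracketWorm.br.sizeOf_spec] at ha
    obtain ⟨l, hl⟩ := ih fun c hc => ha c (by omega)
    exact ⟨⟨a, ha a (by omega)⟩ :: l, congrArg (BCFormula.br a) hl⟩

/-- All bracket notations are comparable: those inside `a` and `b` are so inductively, hence so are
`a` and `b` as worms in a calculus with linearly ordered modalities. -/
theorem comparable (a b : BracketWorm) : Comparable V a b := by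
  induction hn : max (sizeOf a) (sizeOf b) using Nat.strong_induction_on generalizing a b with
  | _ n ih =>
  by_cases h1 : n ≤ 1
  · have htop : ∀ c : BracketWorm, sizeOf c ≤ 1 → c = .top := by
      rintro (_ | ⟨c, d⟩) h
      · rfl
      · have : 0 < sizeOf c := by cases c <;> simp
        have : 0 < sizeOf d := by cases d <;> simp
        simp only [BracketWorm.br.sizeOf_spec] at h
        omega
    rw [htop a (by omega), htop b (by omega)]
    exact Or.inr (Or.inl ⟨.refl _, .refl _⟩)
  · have hS : ∀ a ∈ {c : BracketWorm | sizeOf c < n}, ∀ b ∈ {c : BracketWorm | sizeOf c < n},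
        Comparable V a b := fun a ha b hb => ih _ (max_lt ha hb) a b rfl
    obtain ⟨l, hl⟩ := exists_worm_eq_toFormula (V := V) (a := a) hS
      fun c hc => hc.trans_le (by omega)
    obtain ⟨m, hm⟩ := exists_worm_eq_toFormula (V := V) (a := b) hS
      fun c hc => hc.trans_le (by omega)
    have hbot (i : {c : BracketWorm | sizeOf c < n}) :
        BracketWorm.top.oStar V ≤ i.1.oStar V := oStar_top.trans_le (zero_le (a := _))
    have htop : BracketWorm.top ∈ {c : BracketWorm | sizeOf c < n} := by
      simp only [Set.mem_ofPred_eq, BracketWorm.top.sizeOf_spec]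
      omega
    have h := (bcCalculus _ hS).precedes_trichotomy (i := ⟨.top, htop⟩) (l := l) (m := m)
      (fun k _ => hbot k) (fun k _ => hbot k)
    simp only [ReflectionCalculus.Precedes, ReflectionCalculus.Equivalent, hl, hm] at h
    exact h.imp And.left (Or.imp And.left And.left)

theorem br_le_br {a b : BracketWorm} (h : b.oStar V ≤ a.oStar V) {φ ψ : BCFormula V}
    (hφψ : BC φ ψ) : BC (.br a φ) (.br b ψ) :=
  (comparable a b).br_le_br h hφψ

/-! ### The canonical model of the bracket calculus -/

variable (V) in
/-- Theories of the bracket calculus: the worlds of its canonical model. -/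
structure Theory where
  /-- The formulas that belong to the theory. -/
  carrier : Set (BCFormula V)
  top_mem : .top ∈ carrier
  and_mem : ∀ {φ ψ}, φ ∈ carrier → ψ ∈ carrier → .and φ ψ ∈ carrier
  mem_of_bc : ∀ {φ ψ}, φ ∈ carrier → BC φ ψ → ψ ∈ carrier

/-- The accessibility relation for `⟨α⟩`. It makes sense for every ordinal `α`, whether or not
`α` is of the form `o*(a)`. -/
def Theory.Rel (α : Ordinal.{0}) (x y : Theory V) : Prop :=
  (∀ b φ, b.oStar V ≤ α → φ ∈ y.carrier → .br b φ ∈ x.carrier) ∧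
    ∀ b φ, b.oStar V < α → (.br b φ ∈ x.carrier ↔ .br b φ ∈ y.carrier)

/-- Truth of a formula of the reflection calculus in a world of the canonical model. -/
def Theory.Sat (x : Theory V) : RCFormula V → Prop
  | .top => True
  | .var p => .var p ∈ x.carrier
  | .and φ ψ => x.Sat φ ∧ x.Sat ψ
  | .dia α φ => ∃ y, x.Rel α y ∧ y.Sat φ

theorem Theory.Rel.trans {α : Ordinal.{0}} {x y z : Theory V} (hxy : x.Rel α y)
    (hyz : y.Rel α z) : x.Rel α z :=
  ⟨fun b φ hb hφ => x.mem_of_bc (hxy.1 b _ hb (hyz.1 b φ hb hφ)) (.br_br_le (.refl φ) (.refl _)),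
    fun b φ hb => (hxy.2 b φ hb).trans (hyz.2 b φ hb)⟩

theorem Theory.Rel.mono {α β : Ordinal.{0}} {x y : Theory V} (hβα : β < α) (h : x.Rel α y) :
    x.Rel β y :=
  ⟨fun b φ hb => h.1 b φ (hb.trans hβα.le), fun b φ hb => h.2 b φ (hb.trans hβα)⟩

theorem Theory.Rel.euclidean {α β : Ordinal.{0}} {x y z : Theory V} (hβα : β < α)
    (hxy : x.Rel α y) (hxz : x.Rel β z) : y.Rel β z :=
  ⟨fun b φ hb hφ => (hxy.2 b φ (hb.trans_lt hβα)).1 (hxz.1 b φ hb hφ),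
    fun b φ hb => (hxy.2 b φ (hb.trans hβα)).symm.trans (hxz.2 b φ hb)⟩

/-- Soundness of the model for modalities `⟨α⟩` with arbitrary `α`. -/
theorem RC.sat {Λ : Ordinal.{0}} {φ ψ : RCFormula V} (h : RC Λ φ ψ) (x : Theory V)
    (hx : x.Sat φ) : x.Sat ψ := by
  induction h generalizing x with
  | refl _ => exact hx
  | top _ => trivial
  | and_left _ _ => exact hx.1
  | and_right _ _ => exact hx.2
  | dia_dia _ _ =>
    obtain ⟨y, hxy, z, hyz, hz⟩ := hx
    exact ⟨z, hxy.trans hyz, hz⟩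
  | dia_mono _ hβα _ =>
    obtain ⟨y, hxy, hy⟩ := hx
    exact ⟨y, hxy.mono hβα, hy⟩
  | dia_and _ hβα _ _ =>
    obtain ⟨⟨y, hxy, hy⟩, z, hxz, hz⟩ := hx
    exact ⟨y, hxy, hy, z, hxy.euclidean hβα hxz, hz⟩
  | and_intro _ _ ih₁ ih₂ => exact ⟨ih₁ x hx, ih₂ x hx⟩
  | cut _ _ ih₁ ih₂ => exact ih₂ x (ih₁ x hx)
  | dia_congr _ _ ih =>
    obtain ⟨y, hxy, hy⟩ := hx
    exact ⟨y, hxy, ih y hy⟩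

/-- The successor of `x` witnessing `(a) φ ∈ x` is the theory generated by `φ` and by those
formulas `θ ∈ x` that can be moved under the modality `(a)`. -/
theorem Theory.exists_rel {x : Theory V} {a : BracketWorm} {φ : BCFormula V}
    (h : .br a φ ∈ x.carrier) : ∃ y, x.Rel (a.oStar V) y ∧ φ ∈ y.carrier := by
  let Movable (θ : BCFormula V) : Prop :=
    θ ∈ x.carrier ∧ ∀ ψ : BCFormula V, BC (.and (.br a ψ) θ) (.br a (.and ψ θ))
  have movable_top : Movable .top := ⟨x.top_mem, fun ψ =>
    (BC.and_left _ _).cut (.br_le (.and_intro (.refl _) (.top _)) (.refl _))⟩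
  have movable_and {θ θ'} (hθ : Movable θ) (hθ' : Movable θ') : Movable (.and θ θ') := by
    refine ⟨x.and_mem hθ.1 hθ'.1, fun ψ => ?_⟩
    have h1 : BC (.and (.br a ψ) (.and θ θ')) (.and (.br a (.and ψ θ)) θ') :=
      .and_intro ((BC.and_intro (.and_left _ _) ((BC.and_right _ _).cut (.and_left _ _))).cut
        (hθ.2 ψ)) ((BC.and_right _ _).cut (.and_right _ _))
    refine (h1.cut (hθ'.2 _)).cut (.br_le ?_ (.refl _))
    exact .and_intro ((BC.and_left _ _).cut (.and_left _ _))
      (.and_intro ((BC.and_left _ _).cut (.and_right _ _)) (.and_right _ _))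
  let y : Theory V :=
    { carrier := {χ | ∃ θ, Movable θ ∧ BC (.and φ θ) χ}
      top_mem := ⟨.top, movable_top, .top _⟩
      and_mem := by
        rintro χ χ' ⟨θ, hθ, hχ⟩ ⟨θ', hθ', hχ'⟩
        refine ⟨.and θ θ', movable_and hθ hθ', .and_intro (.cut ?_ hχ) (.cut ?_ hχ')⟩
        · exact .and_intro (.and_left _ _) ((BC.and_right _ _).cut (.and_left _ _))
        · exact .and_intro (.and_left _ _) ((BC.and_right _ _).cut (.and_right _ _))
      mem_of_bc := by
        rintro χ χ' ⟨θ, hθ, hχ⟩ hχχ'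
        exact ⟨θ, hθ, hχ.cut hχχ'⟩ }
  have hbr {b χ} (hb : b.oStar V ≤ a.oStar V) (hχ : χ ∈ y.carrier) : .br b χ ∈ x.carrier := by
    obtain ⟨θ, hθ, hχ⟩ := hχ
    exact x.mem_of_bc (x.and_mem h hθ.1) ((hθ.2 φ).cut (br_le_br hb hχ))
  refine ⟨y, ⟨fun b χ => hbr, fun b χ hb => ⟨fun hχ => ?_, fun hχ => ?_⟩⟩,
    ⟨.top, movable_top, .and_left _ _⟩⟩
  · exact ⟨.br b χ, ⟨hχ, fun ψ => .br_and ((comparable a b).bc_of_lt hb)⟩, .and_right _ _⟩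
  · exact x.mem_of_bc (hbr hb.le hχ) (.br_br_le (.refl χ) (.refl _))

theorem Theory.sat_tau (x : Theory V) (φ : BCFormula V) : x.Sat φ.tau ↔ φ ∈ x.carrier := by
  induction φ generalizing x with
  | top => exact ⟨fun _ => x.top_mem, fun _ => trivial⟩
  | var p => exact Iff.rfl
  | and φ ψ ih₁ ih₂ =>
    refine ((ih₁ x).and (ih₂ x)).trans ⟨fun h => x.and_mem h.1 h.2, fun h => ?_⟩
    exact ⟨x.mem_of_bc h (.and_left _ _), x.mem_of_bc h (.and_right _ _)⟩
  | br a φ ih =>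
    constructor
    · rintro ⟨y, hxy, hy⟩
      exact hxy.1 a φ le_rfl ((ih y).1 hy)
    · intro h
      obtain ⟨y, hxy, hy⟩ := Theory.exists_rel h
      exact ⟨y, hxy, (ih y).2 hy⟩

theorem bc_of_rc_tau {φ ψ : BCFormula V} (h : RC (gamma 0) φ.tau ψ.tau) : BC φ ψ := by
  let x : Theory V :=
    { carrier := {χ | BC φ χ}
      top_mem := .top φ
      and_mem := .and_intro
      mem_of_bc := .cut }
  exact (x.sat_tau ψ).1 (h.sat x ((x.sat_tau φ).2 (.refl φ)))

end Bracket

end BracketCalculus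

/-- The first conjunct says that the consistency ordering of the worms of `𝕎_{Γ₀}` is well-founded,
so that the recursion defining the order types `o(A)`, and hence `o*` and `τ`, is a genuine one; the
second says that `τ` maps into the language of `RC_{Γ₀}`. -/
theorem mainTheorem1 {V : Type u} :
    WellFounded (BracketCalculus.WormLT (V := V) (Ordinal.gamma 0)) ∧
    (∀ φ : BracketCalculus.BCFormula V, φ.tau ∈ BracketCalculus.lang V (Ordinal.gamma 0)) ∧
    ∀ φ ψ : BracketCalculus.BCFormula V,
      BracketCalculus.BC φ ψ ↔ BracketCalculus.RC (Ordinal.gamma 0) φ.tau ψ.tau :=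
  ⟨BracketCalculus.wellFounded_wormLT Ordinal.gamma_pos, BracketCalculus.tau_mem_lang,
    fun _ _ => ⟨BracketCalculus.BC.rc_tau, BracketCalculus.bc_of_rc_tau⟩⟩
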